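/- Let $0<\rho\le v_{\max}$. A buyer with total budget $B=\rho T$ takes part in $T$ repeated second-price auctions. In round $t$ she sees her value $v_t\in[0,v_{\max}]$, decides $x_t\in\{0,1\}$ (enter or not), and gets revenue $x_t r_t$ and pays $x_t c_t$, where $r_t=(v_t-p_t)^+$, $c_t=p_t\mathbf 1[v_t\ge p_t]$ and $p_t$ is the highest competing bid. The values $\bm v\in[0,v_{\max}]^T$ are arbitrary (adversarial), the bids $p_1,\dots,p_T$ are i.i.d. from a probability distribution $G$ on $[0,v_{\max}]$ unknown to the buyer, and $p_t$ is revealed at the end of round $t$ whatever $x_t$ is (full information feedback). The OGD-CB algorithm starts with $B_1=\rho T$, $\lambda_1=0$, $\mathcal I_1=\emptyset$ and does the following for $t=1,\dots,T$. If $t=1$, it sets $x_1=1$ and $\lambda_2=\lambda_1$. If $t\ge2$, it sets $$\epsilon_t=\sqrt{\tfrac{\ln 2+2\ln T}{2|\mathcal I_t|}},\quad \tilde r_t=\frac{1}{|\mathcal I_t|}\sum_{\tau\in\mathcal I_t}(v_t-p_\tau)^++\epsilon_tv_t,\quad \tilde c_t=\frac1{|\mathcal I_t|}\sum_{\tau\in\mathcal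 I_t}p_\tau\mathbf 1[v_t\ge p_\tau]-2\epsilon_tv_t,$$ $$x_t=\mathbf 1[\tilde r_t\ge\lambda_t\tilde c_t],\qquad \lambda_{t+1}=\Bigl(\lambda_t+\tfrac{1}{v_{\max}\sqrt t}(x_t\tilde c_t-\rho)\Bigr)^+ .$$ In either case it then observes $p_t$, sets $\mathcal I_{t+1}=\mathcal I_t\cup\{t\}$ and $B_{t+1}=B_t-x_tc_t$, and stops for good (all later decisions are $0$) if $B_{t+1}<v_{\max}$. Let $\mathrm{Rev}_T(\bm v,\bm p)=\sum_{t=1}^T x_tr_t$ be the total revenue of OGD-CB, and let $$\mathrm{OPT}^{\mathrm H}_T(\bm v,\bm p)=\max\Bigl\{\sum_{t=1}^T y_t(v_t-p_t)^+ : \bm y\in\{0,1\}^T,\ \sum_{t=1}^T y_tp_t\mathbf 1[v_t\ge p_t]\le T\rho\Bigr\}$$ be the hindsight benchmark. Then OGD-CB is asymptotically $(\rho/v_{\max})$-competitive: the random variable in the expectation below is integrable for all $T$, $\bm v$, $G$, and $$\liminf_{T\to\infty}\ \inf_{\bm v\in[0,v_{\max}]^T,\ G}\ \frac1T\,\mathbb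 E_{\bm p\sim G^T}\Bigl[\mathrm{Rev}_T(\bm v,\bm p)-\frac{\rho}{v_{\max}}\,\mathrm{OPT}^{\mathrm H}_T(\bm v,\bm p)\Bigr]\ \ge\ 0 .$$ -/

import Mathlib

namespace Throttling

noncomputable section

/-- Revenue `(v - p)⁺` of entering a second-price auction with value `v` against the highest
competing bid `p`. -/
def revenue (v p : ℝ) : ℝ := max (v - p) 0

/-- Cost `p · 1[v ≥ p]` of entering a second-price auction with value `v` against the highest
competing bid `p`. -/
def cost (v p : ℝ) : ℝ := if p ≤ v then p else 0

/-- The hindsight throttling benchmark: the maximum over `x ∈ {0,1}^T` of the total revenue of `x`,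
subject to the total cost of `x` being at most `T ρ`. -/
def hindsight (ρ : ℝ) {T : ℕ} (v p : Fin T → ℝ) : ℝ :=
  sSup {R : ℝ | ∃ x : Fin T → ℝ, (∀ t, x t = 0 ∨ x t = 1) ∧
    ∑ t, x t * cost (v t) (p t) ≤ T * ρ ∧ R = ∑ t, x t * revenue (v t) (p t)}

/-! ### The OGD-CB algorithm with full information feedback

The rounds `1, …, T` are indexed by `t : Fin T`, so that `t` is the round with number `t.val + 1`. -/

/-- The variables of OGD-CB at the start of a round. -/
structure State (T : ℕ) where
  /-- the set of the past rounds whose highest competing bid has been observed -/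
  sampled : Finset (Fin T)
  /-- the remaining budget -/
  budget : ℝ
  /-- the pricing variable -/
  lam : ℝ
  /-- whether the loop has been left by `break` -/
  halted : Bool

/-- The initial variables, with total budget `B = ρ T`. -/
def State.init (ρ : ℝ) (T : ℕ) : State T where
  sampled := ∅
  budget := ρ * T
  lam := 0
  halted := false

/-- The confidence radius `√((ln 2 + 2 ln T) / (2 |I|))`. -/
def radius {T : ℕ} (I : Finset (Fin T)) : ℝ :=
  Real.sqrt ((Real.log 2 + 2 * Real.log T) / (2 * (I.card : ℝ)))

/-- The (optimistic) estimate of the expected revenue at value `w` from the bids observed in `I`. -/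
def estRevenue {T : ℕ} (p : Fin T → ℝ) (I : Finset (Fin T)) (w : ℝ) : ℝ :=
  (∑ τ ∈ I, revenue w (p τ)) / (I.card : ℝ) + radius I * w

/-- The (optimistic) estimate of the expected cost at value `w` from the bids observed in `I`. -/
def estCost {T : ℕ} (p : Fin T → ℝ) (I : Finset (Fin T)) (w : ℝ) : ℝ :=
  (∑ τ ∈ I, cost w (p τ)) / (I.card : ℝ) - 2 * radius I * w

/-- The decision `x_t ∈ {0,1}` in round `t`, at value `w`, from the variables `s` at the start of
the round. The first round is always entered; no round is entered after the loop was left. -/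
def action {T : ℕ} (p : Fin T → ℝ) (s : State T) (t : Fin T) (w : ℝ) : ℝ :=
  if s.halted then 0
  else if t.val = 0 then 1
  else if s.lam * estCost p s.sampled w ≤ estRevenue p s.sampled w then 1
  else 0

/-- The step size `1 / (v_max √t)`. -/
def stepSize (vmax : ℝ) {T : ℕ} (t : Fin T) : ℝ :=
  1 / (vmax * Real.sqrt ((t.val : ℝ) + 1))

/-- The variables after round `t`. With full information feedback `p t` is observed at the end of
the round whatever the decision was. -/
def step (vmax ρ : ℝ) {T : ℕ} (v p : Fin T → ℝ) (s : State T) (t : Fin T) : State T :=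
  if s.halted then s
  else
    { sampled := insert t s.sampled
      budget := s.budget - action p s t (v t) * cost (v t) (p t)
      lam :=
        if t.val = 0 then s.lam
        else max (s.lam +
          stepSize vmax t * (action p s t (v t) * estCost p s.sampled (v t) - ρ)) 0
      halted := decide (s.budget - action p s t (v t) * cost (v t) (p t) < vmax) }

/-- `stateAt vmax ρ v p n`: the variables after the first `n` rounds. -/
def stateAt (vmax ρ : ℝ) {T : ℕ} (v p : Fin T → ℝ) : ℕ → State T
  | 0 => State.init ρ T
  | n + 1 =>
      if h : n < T then step vmax ρ v p (stateAt vmax ρ v p n) ⟨n, h⟩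
      else stateAt vmax ρ v p n

/-- The total revenue of OGD-CB with values `v` and highest competing bids `p`. The decision is `0`
after the last entered round, so summing over all rounds is the same as stopping there. -/
def ogdcbRevenue (vmax ρ : ℝ) {T : ℕ} (v p : Fin T → ℝ) : ℝ :=
  ∑ t : Fin T, action p (stateAt vmax ρ v p t.val) t (v t) * revenue (v t) (p t)

/-- The revenue of OGD-CB minus `μ` times the hindsight benchmark, for values and bids in
`[0, v_max]`. -/
def gap (vmax ρ μ : ℝ) {T : ℕ} (v p : Fin T → Set.Icc (0 : ℝ) vmax) : ℝ :=
  ogdcbRevenue vmax ρ (fun t => (v t : ℝ)) (fun t => (p t : ℝ)) -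
    μ * hindsight ρ (fun t => (v t : ℝ)) (fun t => (p t : ℝ))

end

end Throttling

/-!
The pricing variable `λ` is the price of a unit of budget, and OGD-CB updates it by projected online
gradient ascent in the direction `x c̃ - ρ`; its regret against a fixed price `l ∈ [0, 1]` is
`O(√T log T)`. The decision `x` maximises the priced revenue `x (r̃ - λ c̃)`, so it does at least as
well as the fractional decision `ρ / v_max`; since `c̃ ≤ v_max`, the latter pays at most `λ ρ`,
hence `x r̃ ≥ (ρ / v_max) r̃ + λ (x c̃ - ρ)`. In the sum over the rounds, `λ` can be replaced by `l`
up to the regret. If the budget lasts, `l = 0` finishes the argument; if it runs out, `l = 1` does: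
the total cost of the run is `ρ T` up to `v_max`, which makes up for the rounds after that.

The remaining terms are sampling errors. A decision depends only on earlier bids, so its errors are
martingale differences, orthogonal in `L²`, and sum to `O(√T)` in `L¹`; the empirical mean over `n`
rounds has error `O(1 / √n)` in `L¹`, which again sums to `O(√T)`.
-/

namespace Throttling

open MeasureTheory ProbabilityTheory Finset Filter Topology
open scoped BigOperators

theorem forall_le_of_forall_fin {T : ℕ} {P : ℕ → Prop} (zero : P 0)
    (succ : ∀ t : Fin T, P t → P (t + 1)) {n : ℕ} (hn : n ≤ T) : P n := by
  induction n with
  | zero => exact zero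
  | succ n ih => exact succ ⟨n, hn⟩ (ih (Nat.le_of_succ_le hn))

theorem Iio_eq_empty_of_val_eq_zero {T : ℕ} {t : Fin T} (h : t.val = 0) : Iio t = ∅ :=
  card_eq_zero.1 (by rw [Fin.card_Iio, h])

theorem sum_fin_sub {M : Type*} [AddCommGroup M] (T : ℕ) (f : ℕ → M) :
    ∑ t : Fin T, (f (t + 1) - f t) = f T - f 0 := by
  rw [Fin.sum_univ_eq_sum_range (fun i => f (i + 1) - f i), sum_range_sub]

theorem one_div_sqrt_succ_le (n : ℕ) : 1 / √((n : ℝ) + 1) ≤ 2 * (√((n : ℝ) + 1) - √n) := by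
  have hpos : 0 < √((n : ℝ) + 1) := Real.sqrt_pos.2 (by positivity)
  have hsq : √(n : ℝ) ^ 2 = n := Real.sq_sqrt (by positivity)
  have hsq_succ : √((n : ℝ) + 1) ^ 2 = n + 1 := Real.sq_sqrt (by positivity)
  rw [div_le_iff₀ hpos]
  nlinarith [sq_nonneg (√((n : ℝ) + 1) - √n)]

theorem sum_fin_one_div_sqrt_succ_le (T : ℕ) : ∑ t : Fin T, 1 / √((t : ℝ) + 1) ≤ 2 * √T := by
  calc ∑ t : Fin T, 1 / √((t : ℝ) + 1)
    _ ≤ ∑ t : Fin T, 2 * (√((t + 1 : ℕ) : ℝ) - √(t : ℝ)) :=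
        sum_le_sum fun t _ => by simpa only [Nat.cast_succ] using one_div_sqrt_succ_le t
    _ = 2 * √T := by
        rw [← mul_sum, sum_fin_sub T fun n => √(n : ℝ), Nat.cast_zero, Real.sqrt_zero, sub_zero]

theorem one_div_sqrt_le_two_mul_one_div_sqrt_succ (n : ℕ) :
    1 / √(n : ℝ) ≤ 2 * (1 / √((n : ℝ) + 1)) := by
  rcases Nat.eq_zero_or_pos n with rfl | hn
  · simp
  · have hn' : (1 : ℝ) ≤ n := by exact_mod_cast hn
    have hsucc : √((n : ℝ) + 1) ≤ 2 * √n := by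
      rw [Real.sqrt_le_left (by positivity), mul_pow, Real.sq_sqrt (by positivity)]
      linarith
    rw [mul_one_div, div_le_div_iff₀ (by positivity) (by positivity), one_mul]
    exact hsucc

theorem abs_sub_le_one_of_mem_Icc {a b : ℝ} (ha : a ∈ Set.Icc 0 1) (hb : b ∈ Set.Icc 0 1) :
    |a - b| ≤ 1 := by
  simpa using abs_sub_le_of_le_of_le ha.1 ha.2 hb.1 hb.2

theorem mul_le_abs_of_abs_le_one {a x : ℝ} (ha : |a| ≤ 1) : a * x ≤ |x| :=
  (le_abs_self _).trans (by rw [abs_mul]; exact mul_le_of_le_one_left (abs_nonneg x) ha)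

section GradientAscent

variable {E : Type*} [NormedAddCommGroup E] [InnerProductSpace ℝ E] {l x y g : E}

theorem inner_sub_le_of_gradient_step {η : ℝ} (hη : 0 < η) (hstep : ‖y - l‖ ≤ ‖x + η • g - l‖) :
    inner ℝ g (l - x) ≤ (‖x - l‖ ^ 2 - ‖y - l‖ ^ 2) / (2 * η) + η * ‖g‖ ^ 2 / 2 := by
  have hsq : ‖y - l‖ ^ 2 ≤ ‖x - l‖ ^ 2 - 2 * η * inner ℝ g (l - x) + η ^ 2 * ‖g‖ ^ 2 := by
    calc ‖y - l‖ ^ 2 ≤ ‖(x - l) + η • g‖ ^ 2 := by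
          rw [← add_sub_right_comm]; gcongr
      _ = ‖x - l‖ ^ 2 - 2 * η * inner ℝ g (l - x) + η ^ 2 * ‖g‖ ^ 2 := by
          rw [norm_add_sq_real, inner_smul_right, norm_smul, mul_pow, Real.norm_eq_abs, sq_abs,
            ← neg_sub x l, inner_neg_right, real_inner_comm]
          ring
  field_simp
  linarith

/-- The regret bound of online gradient ascent with step sizes `1 / (D √t)`: `l` is the comparator,
and a projection onto a convex set containing `l` is allowed in `step`. -/
theorem sum_inner_sub_le_of_gradient_steps {T : ℕ} {x : ℕ → E} {g : Fin T → E} {D R K : ℝ}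
    (hD : 0 < D) (hx : ∀ n ≤ T, ‖x n - l‖ ≤ R) (hg : ∀ t, ‖g t‖ ≤ K)
    (step : ∀ t : Fin T, ‖x (t + 1) - l‖ ≤ ‖x t + (1 / (D * √((t : ℝ) + 1))) • g t - l‖) :
    ∑ t : Fin T, inner ℝ (g t) (l - x t) ≤ √T * (D * R ^ 2 / 2 + K ^ 2 / D) := by
  -- Abel summation: the potential absorbs the growth of the inverse step size.
  let Φ : ℕ → ℝ := fun n => D * √n / 2 * (R ^ 2 - ‖x n - l‖ ^ 2) + K ^ 2 / D * √n
  have hround : ∀ t : Fin T, inner ℝ (g t) (l - x t) ≤ Φ (t + 1) - Φ t := fun t => by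
    have hR : ‖x t - l‖ ^ 2 ≤ R ^ 2 := by gcongr; exact hx t t.isLt.le
    have hK : ‖g t‖ ^ 2 ≤ K ^ 2 := by gcongr; exact hg t
    have hdescent := inner_sub_le_of_gradient_step (by positivity) (step t)
    have hsqrt : √(t : ℝ) ≤ √((t : ℝ) + 1) := Real.sqrt_le_sqrt (by linarith)
    have hdist : 0 ≤ D / 2 * ((√((t : ℝ) + 1) - √t) * (R ^ 2 - ‖x t - l‖ ^ 2)) :=
      mul_nonneg (by positivity) (mul_nonneg (sub_nonneg.2 hsqrt) (sub_nonneg.2 hR))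
    have hgrad : 1 / (D * √((t : ℝ) + 1)) * ‖g t‖ ^ 2 / 2 ≤
        K ^ 2 / D * (√((t : ℝ) + 1) - √t) := by
      calc 1 / (D * √((t : ℝ) + 1)) * ‖g t‖ ^ 2 / 2
        _ = ‖g t‖ ^ 2 / (2 * D) * (1 / √((t : ℝ) + 1)) := by field_simp
        _ ≤ K ^ 2 / (2 * D) * (2 * (√((t : ℝ) + 1) - √t)) := by
            gcongr; exact one_div_sqrt_succ_le t
        _ = K ^ 2 / D * (√((t : ℝ) + 1) - √t) := by field_simp
    have hinv : (‖x t - l‖ ^ 2 - ‖x (t + 1) - l‖ ^ 2) / (2 * (1 / (D * √((t : ℝ) + 1)))) =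
        D * √((t : ℝ) + 1) / 2 * (‖x t - l‖ ^ 2 - ‖x (t + 1) - l‖ ^ 2) := by
      field_simp
    simp only [Φ, Nat.cast_succ]
    linarith
  calc ∑ t : Fin T, inner ℝ (g t) (l - x t)
    _ ≤ Φ T - Φ 0 := (sum_le_sum fun t _ => hround t).trans_eq (sum_fin_sub T Φ)
    _ = √T * (D * R ^ 2 / 2 + K ^ 2 / D) - D * √T / 2 * ‖x T - l‖ ^ 2 := by
        simp only [Φ, Nat.cast_zero, Real.sqrt_zero]; ring
    _ ≤ √T * (D * R ^ 2 / 2 + K ^ 2 / D) := sub_le_self _ (by positivity)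

end GradientAscent

theorem integral_abs_le_sqrt_integral_sq {α : Type*} [MeasurableSpace α] {P : Measure α}
    [IsProbabilityMeasure P] {X : α → ℝ} (hX : MemLp X 2 P) :
    ∫ ω, |X ω| ∂P ≤ √(∫ ω, X ω ^ 2 ∂P) := by
  have hvar := variance_nonneg |X| P
  rw [variance_eq_sub hX.abs] at hvar
  refine Real.le_sqrt_of_sq_le (sub_nonneg.1 hvar |>.trans_eq ?_)
  simp only [Pi.pow_apply, Pi.abs_apply, sq_abs]

theorem integral_abs_sum_le_of_orthogonal {κ α : Type*} [MeasurableSpace α] {P : Measure α}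
    [IsProbabilityMeasure P] (s : Finset κ) {Y : κ → α → ℝ} {B : ℝ} (hY : ∀ i, Measurable (Y i))
    (hY_le : ∀ i ω, |Y i ω| ≤ B) (horth : ∀ i j, i ≠ j → ∫ ω, Y i ω * Y j ω ∂P = 0) :
    ∫ ω, |∑ i ∈ s, Y i ω| ∂P ≤ B * √(#s) := by
  classical
  rcases s.eq_empty_or_nonempty with rfl | ⟨i₀, -⟩
  · simp
  have hB_nonneg : 0 ≤ B :=
    (abs_nonneg _).trans (hY_le i₀ (nonempty_of_isProbabilityMeasure P).some)
  have hYY_le : ∀ i j ω, |Y i ω * Y j ω| ≤ B ^ 2 := fun i j ω => by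
    rw [abs_mul, sq]; exact mul_le_mul (hY_le i ω) (hY_le j ω) (abs_nonneg _) hB_nonneg
  have hYY : ∀ i j, Integrable (fun ω => Y i ω * Y j ω) P := fun i j =>
    .of_bound ((hY i).mul (hY j)).aestronglyMeasurable (B ^ 2) (.of_forall (hYY_le i j))
  have hcov : ∀ i j, ∫ ω, Y i ω * Y j ω ∂P ≤ if i = j then B ^ 2 else 0 := fun i j => by
    split_ifs with hij
    · simpa using integral_mono (hYY i j) (integrable_const (B ^ 2))
        fun ω => (le_abs_self _).trans (hYY_le i j ω)
    · exact (horth i j hij).le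
  have hsq : ∫ ω, (∑ i ∈ s, Y i ω) ^ 2 ∂P ≤ #s * B ^ 2 := by
    calc ∫ ω, (∑ i ∈ s, Y i ω) ^ 2 ∂P
      _ = ∑ i ∈ s, ∑ j ∈ s, ∫ ω, Y i ω * Y j ω ∂P := by
          simp only [sq, sum_mul_sum]
          rw [integral_finsetSum _ fun i _ => integrable_finsetSum _ fun j _ => hYY i j]
          exact sum_congr rfl fun i _ => integral_finsetSum _ fun j _ => hYY i j
      _ ≤ ∑ i ∈ s, ∑ j ∈ s, if i = j then B ^ 2 else 0 := by gcongr; exact hcov _ _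
      _ = #s * B ^ 2 := by simp
  have hmemLp : MemLp (fun ω => ∑ i ∈ s, Y i ω) 2 P :=
    memLp_finsetSum s fun i _ => .of_bound (hY i).aestronglyMeasurable B (.of_forall (hY_le i))
  calc ∫ ω, |∑ i ∈ s, Y i ω| ∂P
    _ ≤ √(#s * B ^ 2) := (integral_abs_le_sqrt_integral_sq hmemLp).trans (Real.sqrt_le_sqrt hsq)
    _ = B * √(#s) := by rw [Real.sqrt_mul (by positivity), Real.sqrt_sq hB_nonneg, mul_comm]

theorem eq_comp_updateFinset_of_dependsOn {ι β : Type*} [DecidableEq ι] {Ω : ι → Type*}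
    {f : (∀ i, Ω i) → β} (s : Finset ι) (hf : DependsOn f s) (ω₀ : ∀ i, Ω i) :
    f = (fun y => f (Function.updateFinset ω₀ s y)) ∘ fun ω (i : s) => ω i :=
  funext fun ω => hf fun i hi => by simp [Function.updateFinset, mem_coe.1 hi]

section ProductMeasure

variable {ι : Type*} [Fintype ι] {Ω : ι → Type*} [∀ i, MeasurableSpace (Ω i)]
  {μ : ∀ i, Measure (Ω i)} [∀ i, IsProbabilityMeasure (μ i)]

theorem indepFun_of_dependsOn_of_disjoint {β γ : Type*} [MeasurableSpace β] [MeasurableSpace γ]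
    {f : (∀ i, Ω i) → β} {g : (∀ i, Ω i) → γ} {s t : Set ι} (hf : Measurable f)
    (hg : Measurable g) (hfs : DependsOn f s) (hgt : DependsOn g t) (hst : Disjoint s t) :
    IndepFun f g (Measure.pi μ) := by
  classical
  let ω₀ : ∀ i, Ω i := fun i => (nonempty_of_isProbabilityMeasure (μ i)).some
  have hindep := (iIndepFun_pi (μ := μ) (X := fun _ => id) fun _ => aemeasurable_id).indepFun_finset
    s.toFinset t.toFinset (Set.disjoint_toFinset.2 hst) fun i => measurable_pi_apply i
  rw [eq_comp_updateFinset_of_dependsOn s.toFinset (f := f) (by simpa using hfs) ω₀,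
    eq_comp_updateFinset_of_dependsOn t.toFinset (f := g) (by simpa using hgt) ω₀]
  exact hindep.comp (hf.comp measurable_updateFinset) (hg.comp measurable_updateFinset)

theorem integral_mul_eval_eq_zero {i : ι} {f : (∀ i, Ω i) → ℝ} {h : Ω i → ℝ} (hf : Measurable f)
    (hfi : DependsOn f {i}ᶜ) (hh : Measurable h) (hzero : ∫ x, h x ∂μ i = 0) :
    ∫ ω, f ω * h (ω i) ∂Measure.pi μ = 0 := by
  have heval : Measurable fun ω : ∀ i, Ω i => h (ω i) := hh.comp (measurable_pi_apply i)
  have hdep : DependsOn (fun ω : ∀ i, Ω i => h (ω i)) {i} := fun ω ω' hω => by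
    simp only [hω i rfl]
  have hindep := indepFun_of_dependsOn_of_disjoint (μ := μ) hf heval hfi hdep disjoint_compl_left
  rw [hindep.integral_fun_mul_eq_mul_integral hf.aestronglyMeasurable heval.aestronglyMeasurable,
    integral_comp_eval hh.aestronglyMeasurable, hzero, mul_zero]

section MartingaleTransform

variable [LinearOrder ι] {X : ι → (∀ i, Ω i) → ℝ} {h : ∀ i, Ω i → ℝ}

theorem integral_mul_eval_mul_mul_eval_eq_zero (hX : ∀ i, Measurable (X i))
    (hdep : ∀ i, DependsOn (X i) (Set.Iio i)) (hh : ∀ i, Measurable (h i))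
    (hzero : ∀ i, ∫ x, h i x ∂μ i = 0) {i j : ι} (hij : i ≠ j) :
    ∫ ω, X i ω * h i (ω i) * (X j ω * h j (ω j)) ∂Measure.pi μ = 0 := by
  wlog hlt : i < j generalizing i j
  · rw [← this hij.symm (hij.lt_or_gt.resolve_left hlt)]
    exact integral_congr_ae (.of_forall fun ω => mul_comm _ _)
  have hmeas : Measurable fun ω => X i ω * h i (ω i) * X j ω :=
    ((hX i).mul ((hh i).comp (measurable_pi_apply i))).mul (hX j)
  have hpast : DependsOn (fun ω => X i ω * h i (ω i) * X j ω) {j}ᶜ := fun ω ω' hω => by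
    simp only [hω i hij, hdep i fun k hk => hω k (hk.trans hlt).ne,
      hdep j fun k hk => hω k (ne_of_lt hk)]
  simpa only [mul_assoc] using integral_mul_eval_eq_zero hmeas hpast (hh j) (hzero j)

theorem integral_abs_sum_mul_sub_integral_le (s : Finset ι) (hX : ∀ i, Measurable (X i))
    (hX_le : ∀ i ω, |X i ω| ≤ 1) (hdep : ∀ i, DependsOn (X i) (Set.Iio i))
    {f : ∀ i, Ω i → ℝ} (hf : ∀ i, Measurable (f i)) {a b : ℝ} (hfab : ∀ i x, f i x ∈ Set.Icc a b) :
    ∫ ω, |∑ i ∈ s, X i ω * (f i (ω i) - ∫ x, f i x ∂μ i)| ∂Measure.pi μ ≤ (b - a) * √(#s) := by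
  have hint : ∀ i, Integrable (f i) (μ i) := fun i =>
    .of_mem_Icc a b (hf i).aemeasurable (.of_forall (hfab i))
  have hmean : ∀ i, ∫ x, f i x ∂μ i ∈ Set.Icc a b := fun i =>
    (convex_Icc a b).integral_mem isClosed_Icc (.of_forall (hfab i)) (hint i)
  have hcenter : ∀ i x, |f i x - ∫ x, f i x ∂μ i| ≤ b - a := fun i x =>
    abs_sub_le_of_le_of_le (hfab i x).1 (hfab i x).2 (hmean i).1 (hmean i).2
  refine integral_abs_sum_le_of_orthogonal s
    (fun i => (hX i).mul (((hf i).comp (measurable_pi_apply i)).sub_const _)) (fun i ω => ?_)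
    fun i j hij => integral_mul_eval_mul_mul_eval_eq_zero hX hdep (h := fun i x =>
      f i x - ∫ x, f i x ∂μ i) (fun i => (hf i).sub_const _) (fun i => ?_) hij
  · rw [abs_mul]
    exact (mul_le_of_le_one_left (abs_nonneg _) (hX_le i ω)).trans (hcenter i _)
  · simp [integral_sub (hint i) (integrable_const _)]

end MartingaleTransform

theorem integral_abs_expect_sub_integral_le {α : Type*} [MeasurableSpace α] {G : Measure α}
    [IsProbabilityMeasure G] [LinearOrder ι] {s : Finset ι} (hs : s.Nonempty) {f : α → ℝ}
    (hf : Measurable f) {a b : ℝ} (hfab : ∀ x, f x ∈ Set.Icc a b) :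
    ∫ ω : ι → α, |(𝔼 i ∈ s, f (ω i)) - ∫ x, f x ∂G| ∂Measure.pi (fun _ => G) ≤
      (b - a) * (1 / √(#s)) := by
  have hcard : (0 : ℝ) < #s := by exact_mod_cast hs.card_pos
  have hscale : ∀ ω : ι → α, |(𝔼 i ∈ s, f (ω i)) - ∫ x, f x ∂G| =
      1 / #s * |∑ i ∈ s, 1 * (f (ω i) - ∫ x, f x ∂G)| := fun ω => by
    rw [← abs_of_pos (one_div_pos.2 hcard), ← abs_mul, expect_eq_sum_div_card]
    simp only [one_mul, sum_sub_distrib, sum_const, nsmul_eq_mul]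
    field_simp
  have hsum := integral_abs_sum_mul_sub_integral_le (X := fun _ _ => 1) (μ := fun _ : ι => G) s
    (fun _ => measurable_const) (fun _ _ => abs_one.le) (fun _ _ _ _ => rfl) (fun _ => hf)
    fun _ => hfab
  simp only [hscale, integral_const_mul]
  calc 1 / #s * ∫ ω : ι → α, |∑ i ∈ s, 1 * (f (ω i) - ∫ x, f x ∂G)| ∂Measure.pi (fun _ => G)
    _ ≤ 1 / #s * ((b - a) * √(#s)) := by gcongr
    _ = (b - a) * (1 / √(#s)) := by
        rw [mul_left_comm, one_div_mul_eq_div, Real.sqrt_div_self']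

end ProductMeasure

section HasIntegralLE

/-- `f` is integrable with integral at most `a`. Carrying integrability along with the bound lets
such bounds be added term by term. -/
def HasIntegralLE {α : Type*} [MeasurableSpace α] (P : Measure α) (f : α → ℝ) (a : ℝ) : Prop :=
  Integrable f P ∧ ∫ x, f x ∂P ≤ a

theorem HasIntegralLE.add {α : Type*} [MeasurableSpace α] {P : Measure α} {f g : α → ℝ} {a b : ℝ}
    (hf : HasIntegralLE P f a) (hg : HasIntegralLE P g b) :
    HasIntegralLE P (fun x => f x + g x) (a + b) :=
  ⟨hf.1.add hg.1, (integral_add hf.1 hg.1).trans_le (add_le_add hf.2 hg.2)⟩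

theorem HasIntegralLE.sum {α κ : Type*} [MeasurableSpace α] {P : Measure α} {s : Finset κ}
    {f : κ → α → ℝ} {a : κ → ℝ} (hf : ∀ i ∈ s, HasIntegralLE P (f i) (a i)) :
    HasIntegralLE P (fun x => ∑ i ∈ s, f i x) (∑ i ∈ s, a i) :=
  ⟨integrable_finsetSum _ fun i hi => (hf i hi).1,
    (integral_finsetSum _ fun i hi => (hf i hi).1).trans_le (sum_le_sum fun i hi => (hf i hi).2)⟩

variable {α : Type*} [MeasurableSpace α] {a b : ℝ}

theorem integrable_comp_eval_of_mem_Icc {ι : Type*} {P : Measure (ι → α)} [IsFiniteMeasure P]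
    {f : α → ℝ} (hf : Measurable f) (hfab : ∀ x, f x ∈ Set.Icc a b) (i : ι) :
    Integrable (fun ω => f (ω i)) P :=
  .of_mem_Icc a b (hf.comp (measurable_pi_apply i)).aemeasurable (.of_forall fun ω => hfab (ω i))

theorem integrable_abs_sum_mul_sub {ι : Type*} {P : Measure (ι → α)} [IsFiniteMeasure P]
    (s : Finset ι) {X : ι → (ι → α) → ℝ} (hX : ∀ i, Measurable (X i)) (hX_le : ∀ i ω, |X i ω| ≤ 1)
    {f : ι → α → ℝ} (hf : ∀ i, Measurable (f i)) (hfab : ∀ i x, f i x ∈ Set.Icc a b)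
    (m : ι → ℝ) : Integrable (fun ω => |∑ i ∈ s, X i ω * (f i (ω i) - m i)|) P :=
  (integrable_finsetSum _ fun i _ => ((integrable_comp_eval_of_mem_Icc (hf i) (hfab i) i).sub
    (integrable_const (m i))).bdd_mul (hX i).aestronglyMeasurable (.of_forall (hX_le i))).abs

theorem integrable_abs_expect_sub {ι : Type*} {P : Measure (ι → α)} [IsFiniteMeasure P]
    (s : Finset ι) {f : α → ℝ} (hf : Measurable f) (hfab : ∀ x, f x ∈ Set.Icc a b)
    (m : ℝ) : Integrable (fun ω => |(𝔼 i ∈ s, f (ω i)) - m|) P := by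
  simp only [expect_eq_sum_div_card]
  exact (((integrable_finsetSum _ fun i _ => integrable_comp_eval_of_mem_Icc hf hfab i).div_const
    _).sub (integrable_const m)).abs

theorem hasIntegralLE_abs_sum_mul_sub_integral {G : Measure α} [IsProbabilityMeasure G]
    {ι : Type*} [Fintype ι] [LinearOrder ι] (s : Finset ι) {X : ι → (ι → α) → ℝ}
    (hX : ∀ i, Measurable (X i)) (hX_le : ∀ i ω, |X i ω| ≤ 1)
    (hdep : ∀ i, DependsOn (X i) (Set.Iio i)) {f : ι → α → ℝ} (hf : ∀ i, Measurable (f i))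
    (hfab : ∀ i x, f i x ∈ Set.Icc a b) :
    HasIntegralLE (Measure.pi fun _ => G)
      (fun ω => |∑ i ∈ s, X i ω * (f i (ω i) - ∫ x, f i x ∂G)|) ((b - a) * √(#s)) :=
  ⟨integrable_abs_sum_mul_sub s hX hX_le hf hfab _,
    integral_abs_sum_mul_sub_integral_le s hX hX_le hdep hf hfab⟩

theorem hasIntegralLE_sum_abs_expect_Iio_sub_integral {T : ℕ} {G : Measure α}
    [IsProbabilityMeasure G] {f : Fin T → α → ℝ} (hf : ∀ t, Measurable (f t)) (hb : 0 ≤ b)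
    (hfb : ∀ t x, f t x ∈ Set.Icc 0 b) :
    HasIntegralLE (Measure.pi fun _ => G)
      (fun ω => ∑ t, |(𝔼 τ ∈ Iio t, f t (ω τ)) - ∫ x, f t x ∂G|) (4 * b * √T) := by
  have hround (t : Fin T) : HasIntegralLE (Measure.pi fun _ => G)
      (fun ω => |(𝔼 τ ∈ Iio t, f t (ω τ)) - ∫ x, f t x ∂G|) (b * (2 * (1 / √((t : ℝ) + 1)))) := by
    refine ⟨integrable_abs_expect_sub _ (hf t) (hfb t) _, ?_⟩
    rcases (Iio t).eq_empty_or_nonempty with hempty | hpast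
    · have hzero : t.val = 0 := by rw [← Fin.card_Iio t, hempty, card_empty]
      have hmean : ∫ x, f t x ∂G ∈ Set.Icc 0 b := (convex_Icc 0 b).integral_mem isClosed_Icc
        (.of_forall (hfb t)) (.of_mem_Icc 0 b (hf t).aemeasurable (.of_forall (hfb t)))
      simp only [hempty, expect_empty, hzero, zero_sub, abs_neg, abs_of_nonneg hmean.1]
      simpa using hmean.2.trans (le_mul_of_one_le_right hb one_le_two)
    · refine (integral_abs_expect_sub_integral_le hpast (hf t) (hfb t)).trans ?_
      rw [sub_zero, Fin.card_Iio]
      exact mul_le_mul_of_nonneg_left (one_div_sqrt_le_two_mul_one_div_sqrt_succ t) hb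
  have hsum := HasIntegralLE.sum fun t (_ : t ∈ univ) => hround t
  refine ⟨hsum.1, hsum.2.trans ?_⟩
  calc ∑ t : Fin T, b * (2 * (1 / √((t : ℝ) + 1)))
    _ = b * (2 * ∑ t : Fin T, 1 / √((t : ℝ) + 1)) := by simp only [mul_sum]
    _ ≤ b * (2 * (2 * √T)) := by gcongr; exact sum_fin_one_div_sqrt_succ_le T
    _ = 4 * b * √T := by ring

end HasIntegralLE

section Estimates

theorem revenue_nonneg (w x : ℝ) : 0 ≤ revenue w x := le_max_right _ _

theorem revenue_mem_Icc {w x : ℝ} (hw : 0 ≤ w) (hx : 0 ≤ x) : revenue w x ∈ Set.Icc 0 w :=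
  ⟨revenue_nonneg w x, max_le (sub_le_self w hx) hw⟩

theorem cost_mem_Icc {w x : ℝ} (hw : 0 ≤ w) (hx : 0 ≤ x) : cost w x ∈ Set.Icc 0 w := by
  unfold cost
  split_ifs with h
  · exact ⟨hx, h⟩
  · exact ⟨le_rfl, hw⟩

theorem expect_mem_Icc {ι : Type*} {s : Finset ι} {f : ι → ℝ} {b : ℝ} (hb : 0 ≤ b)
    (hf : ∀ i, f i ∈ Set.Icc 0 b) : (𝔼 i ∈ s, f i) ∈ Set.Icc 0 b := by
  refine ⟨expect_nonneg fun i _ => (hf i).1, ?_⟩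
  rcases s.eq_empty_or_nonempty with rfl | hs
  · simpa only [expect_empty] using hb
  · exact expect_le hs fun i _ => (hf i).2

/-- The confidence radius without the factor `1 / √|I|` that depends on the sample `I`. -/
noncomputable def radiusScale (T : ℕ) : ℝ := √((Real.log 2 + 2 * Real.log T) / 2)

theorem radiusScale_nonneg (T : ℕ) : 0 ≤ radiusScale T := Real.sqrt_nonneg _

variable {T : ℕ}

theorem radius_nonneg (I : Finset (Fin T)) : 0 ≤ radius I := Real.sqrt_nonneg _

theorem radius_eq_radiusScale_mul (I : Finset (Fin T)) :
    radius I = radiusScale T * (1 / √(#I)) := by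
  rw [radius, radiusScale, ← div_div, Real.sqrt_div' _ (by positivity), mul_one_div]

theorem radius_le_radiusScale (I : Finset (Fin T)) : radius I ≤ radiusScale T := by
  rw [radius_eq_radiusScale_mul]
  refine mul_le_of_le_one_right (radiusScale_nonneg T) ?_
  rcases I.eq_empty_or_nonempty with rfl | hI
  · simp
  · exact div_le_one_of_le₀ (Real.one_le_sqrt.2 (by exact_mod_cast hI.card_pos))
      (Real.sqrt_nonneg _)

theorem sum_radius_Iio_le (T : ℕ) : ∑ t : Fin T, radius (Iio t) ≤ 4 * radiusScale T * √T := by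
  calc ∑ t : Fin T, radius (Iio t)
    _ ≤ ∑ t : Fin T, radiusScale T * (2 * (1 / √((t : ℝ) + 1))) := by
        gcongr with t
        rw [radius_eq_radiusScale_mul, Fin.card_Iio]
        exact mul_le_mul_of_nonneg_left (one_div_sqrt_le_two_mul_one_div_sqrt_succ t)
          (radiusScale_nonneg T)
    _ = radiusScale T * (2 * ∑ t : Fin T, 1 / √((t : ℝ) + 1)) := by simp only [mul_sum]
    _ ≤ radiusScale T * (2 * (2 * √T)) := by
        gcongr
        · exact radiusScale_nonneg T
        · exact sum_fin_one_div_sqrt_succ_le T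
    _ = 4 * radiusScale T * √T := by ring

theorem estRevenue_eq_expect (p : Fin T → ℝ) (I : Finset (Fin T)) (w : ℝ) :
    estRevenue p I w = (𝔼 τ ∈ I, revenue w (p τ)) + radius I * w := by
  rw [estRevenue, expect_eq_sum_div_card]

theorem estCost_eq_expect (p : Fin T → ℝ) (I : Finset (Fin T)) (w : ℝ) :
    estCost p I w = (𝔼 τ ∈ I, cost w (p τ)) - 2 * radius I * w := by
  rw [estCost, expect_eq_sum_div_card]

theorem estRevenue_empty (p : Fin T → ℝ) (w : ℝ) : estRevenue p ∅ w = 0 := by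
  simp [estRevenue, radius]

theorem estCost_empty (p : Fin T → ℝ) (w : ℝ) : estCost p ∅ w = 0 := by
  simp [estCost, radius]

theorem estRevenue_le {p : Fin T → ℝ} (hp : ∀ t, 0 ≤ p t) (I : Finset (Fin T)) {w b : ℝ}
    (hw : w ∈ Set.Icc 0 b) : estRevenue p I w ≤ b * (1 + radiusScale T) := by
  have hmean := (expect_mem_Icc (s := I) hw.1 fun t => revenue_mem_Icc hw.1 (hp t)).2
  have hbonus : radius I * w ≤ radiusScale T * b :=
    mul_le_mul (radius_le_radiusScale I) hw.2 hw.1 (radiusScale_nonneg T)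
  rw [estRevenue_eq_expect]
  linarith [hw.2]

theorem estCost_mem_Icc {p : Fin T → ℝ} (hp : ∀ t, 0 ≤ p t) (I : Finset (Fin T)) {w b : ℝ}
    (hw : w ∈ Set.Icc 0 b) : estCost p I w ∈ Set.Icc (-(2 * radiusScale T * b)) b := by
  have hmean := expect_mem_Icc (s := I) hw.1 fun t => cost_mem_Icc hw.1 (hp t)
  have hbonus : radius I * w ≤ radiusScale T * b :=
    mul_le_mul (radius_le_radiusScale I) hw.2 hw.1 (radiusScale_nonneg T)
  have hbonus_nonneg : 0 ≤ radius I * w := mul_nonneg (radius_nonneg I) hw.1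
  rw [estCost_eq_expect]
  constructor <;> linarith [hmean.1, hmean.2, hw.2]

theorem abs_sub_estRevenue_le {p : Fin T → ℝ} {I : Finset (Fin T)} {w b r : ℝ}
    (hw : w ∈ Set.Icc 0 b) :
    |r - estRevenue p I w| ≤ |(𝔼 τ ∈ I, revenue w (p τ)) - r| + b * radius I := by
  have hbonus_nonneg : 0 ≤ radius I * w := mul_nonneg (radius_nonneg I) hw.1
  have hbonus : radius I * w ≤ radius I * b := mul_le_mul_of_nonneg_left hw.2 (radius_nonneg I)
  rw [estRevenue_eq_expect, abs_sub_comm, add_sub_right_comm]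
  refine (abs_add_le _ _).trans ?_
  rw [abs_of_nonneg hbonus_nonneg]
  linarith

theorem abs_sub_estCost_le {p : Fin T → ℝ} {I : Finset (Fin T)} {w b c : ℝ}
    (hw : w ∈ Set.Icc 0 b) :
    |c - estCost p I w| ≤ |(𝔼 τ ∈ I, cost w (p τ)) - c| + 2 * b * radius I := by
  have hbonus_nonneg : 0 ≤ radius I * w := mul_nonneg (radius_nonneg I) hw.1
  have hbonus : radius I * w ≤ radius I * b := mul_le_mul_of_nonneg_left hw.2 (radius_nonneg I)
  rw [estCost_eq_expect, abs_sub_comm, sub_right_comm]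
  refine (abs_sub _ _).trans ?_
  rw [mul_assoc, abs_of_nonneg (mul_nonneg zero_le_two hbonus_nonneg)]
  linarith

end Estimates

section Run

variable {vmax ρ : ℝ} {T : ℕ} {v p : Fin T → ℝ}

theorem stateAt_succ (t : Fin T) :
    stateAt vmax ρ v p (t + 1) = step vmax ρ v p (stateAt vmax ρ v p t) t := dif_pos t.isLt

/-- The decision `x_t` of OGD-CB in round `t`. -/
noncomputable def decision (vmax ρ : ℝ) {T : ℕ} (v p : Fin T → ℝ) (t : Fin T) : ℝ :=
  action p (stateAt vmax ρ v p t) t (v t)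

theorem sampled_stateAt_of_not_halted {n : ℕ} (hn : n ≤ T)
    (hhalted : ¬(stateAt vmax ρ v p n).halted) :
    (stateAt vmax ρ v p n).sampled = univ.filter fun τ : Fin T => τ.val < n := by
  refine forall_le_of_forall_fin (P := fun n => ¬(stateAt vmax ρ v p n).halted →
    (stateAt vmax ρ v p n).sampled = univ.filter fun τ : Fin T => τ.val < n) (fun _ => ?_)
    (fun t ih => ?_) hn hhalted
  · simp [stateAt, State.init]
  · rw [stateAt_succ, step]
    by_cases hhalted : (stateAt vmax ρ v p t).halted
    · rw [if_pos hhalted]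
      exact fun h => absurd hhalted h
    · rw [if_neg hhalted]
      intro _
      ext τ
      simp only [ih hhalted, mem_insert, mem_filter, mem_univ, true_and, Fin.ext_iff]
      lia

theorem sampled_stateAt_eq_Iio {t : Fin T} (hhalted : ¬(stateAt vmax ρ v p t).halted) :
    (stateAt vmax ρ v p t).sampled = Iio t := by
  rw [sampled_stateAt_of_not_halted t.isLt.le hhalted]
  ext τ
  simp

-- In the first round both estimates are `0` because of `x / 0 = 0`, hence the test that governs the
-- later rounds agrees with the prescribed decision.
theorem decision_eq (t : Fin T) :
    decision vmax ρ v p t = if (stateAt vmax ρ v p t).halted then 0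
      else if (stateAt vmax ρ v p t).lam * estCost p (Iio t) (v t) ≤ estRevenue p (Iio t) (v t)
        then 1 else 0 := by
  unfold decision action
  by_cases hhalted : (stateAt vmax ρ v p t).halted
  · rw [if_pos hhalted, if_pos hhalted]
  rw [if_neg hhalted, if_neg hhalted, sampled_stateAt_eq_Iio hhalted]
  by_cases hzero : t.val = 0
  · simp [hzero, Iio_eq_empty_of_val_eq_zero hzero, estRevenue_empty, estCost_empty]
  · rw [if_neg hzero]

theorem decision_mem_Icc (t : Fin T) : decision vmax ρ v p t ∈ Set.Icc 0 1 := by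
  rw [decision_eq]
  split_ifs <;> simp

theorem decision_eq_zero_of_halted {t : Fin T} (h : (stateAt vmax ρ v p t).halted) :
    decision vmax ρ v p t = 0 := by rw [decision_eq, if_pos h]

theorem ogdcbRevenue_eq_sum_decision :
    ogdcbRevenue vmax ρ v p = ∑ t, decision vmax ρ v p t * revenue (v t) (p t) := rfl

theorem budget_stateAt_succ (t : Fin T) :
    (stateAt vmax ρ v p (t + 1)).budget =
      (stateAt vmax ρ v p t).budget - decision vmax ρ v p t * cost (v t) (p t) := by
  rw [stateAt_succ, step]
  by_cases hhalted : (stateAt vmax ρ v p t).halted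
  · rw [if_pos hhalted, decision_eq_zero_of_halted hhalted, zero_mul, sub_zero]
  · rw [if_neg hhalted, decision]

theorem budget_stateAt_last :
    (stateAt vmax ρ v p T).budget = ρ * T - ∑ t, decision vmax ρ v p t * cost (v t) (p t) := by
  have htelescope := sum_fin_sub T fun n => (stateAt vmax ρ v p n).budget
  simp only [budget_stateAt_succ, sub_sub_cancel_left, sum_neg_distrib] at htelescope
  have hinit : (stateAt vmax ρ v p 0).budget = ρ * T := rfl
  linarith

theorem halted_stateAt_succ (t : Fin T) :
    (stateAt vmax ρ v p (t + 1)).halted ↔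
      (stateAt vmax ρ v p t).halted ∨ (stateAt vmax ρ v p (t + 1)).budget < vmax := by
  rw [stateAt_succ, step]
  split_ifs with hhalted <;> simp [hhalted]

theorem monotone_halted_stateAt : Monotone fun n => (stateAt vmax ρ v p n).halted := by
  refine monotone_nat_of_le_succ fun n => ?_
  by_cases hn : n < T
  · exact fun h => (halted_stateAt_succ ⟨n, hn⟩).2 (.inl h)
  · simp [stateAt, hn]

theorem budget_stateAt_lt_of_halted {n : ℕ} (hn : n ≤ T) :
    (stateAt vmax ρ v p n).halted → (stateAt vmax ρ v p n).budget < vmax := by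
  refine forall_le_of_forall_fin (P := fun n => (stateAt vmax ρ v p n).halted →
    (stateAt vmax ρ v p n).budget < vmax) (fun h => absurd h Bool.false_ne_true)
    (fun t ih h => ?_) hn
  rcases (halted_stateAt_succ t).1 h with hhalted | hbudget
  · rw [budget_stateAt_succ, decision_eq_zero_of_halted hhalted, zero_mul, sub_zero]
    exact ih hhalted
  · exact hbudget

/-- The estimated amount by which the spending in round `t` exceeds the budget rate `ρ`. It is the
ascent direction of the pricing variable; it is set to `0` after the loop was left, when that
variable does not move any more. -/
noncomputable def overspend (vmax ρ : ℝ) {T : ℕ} (v p : Fin T → ℝ) (t : Fin T) : ℝ :=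
  if (stateAt vmax ρ v p t).halted then 0 else decision vmax ρ v p t * estCost p (Iio t) (v t) - ρ

theorem lam_stateAt_nonneg {n : ℕ} (hn : n ≤ T) : 0 ≤ (stateAt vmax ρ v p n).lam := by
  refine forall_le_of_forall_fin (P := fun n => 0 ≤ (stateAt vmax ρ v p n).lam) le_rfl
    (fun t ih => ?_) hn
  rw [stateAt_succ, step]
  by_cases hhalted : (stateAt vmax ρ v p t).halted
  · rwa [if_pos hhalted]
  by_cases hzero : t.val = 0
  · rwa [if_neg hhalted, if_pos hzero]
  · rw [if_neg hhalted, if_neg hzero]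
    exact le_max_right _ _

theorem stepSize_pos (hvmax : 0 < vmax) (t : Fin T) : 0 < stepSize vmax t := by
  unfold stepSize; positivity

theorem lam_stateAt_succ (hρ : 0 < ρ) (hvmax : 0 < vmax) (t : Fin T) :
    (stateAt vmax ρ v p (t + 1)).lam =
      max ((stateAt vmax ρ v p t).lam + stepSize vmax t * overspend vmax ρ v p t) 0 := by
  rw [stateAt_succ, step, overspend]
  by_cases hhalted : (stateAt vmax ρ v p t).halted
  · rw [if_pos hhalted, if_pos hhalted, mul_zero, add_zero,
      max_eq_left (lam_stateAt_nonneg t.isLt.le)]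
  rw [if_neg hhalted, if_neg hhalted]
  by_cases hzero : t.val = 0
  · have hlam : (stateAt vmax ρ v p t).lam = 0 := by rw [hzero]; rfl
    rw [if_pos hzero, hlam, Iio_eq_empty_of_val_eq_zero hzero, estCost_empty, mul_zero, zero_sub,
      zero_add, max_eq_right]
    exact mul_nonpos_of_nonneg_of_nonpos (stepSize_pos hvmax t).le (neg_nonpos.2 hρ.le)
  · rw [if_neg hzero, sampled_stateAt_eq_Iio hhalted, decision]

theorem overspend_mem_Icc (hρ : 0 < ρ) (hρv : ρ ≤ vmax) (hv : ∀ t, v t ∈ Set.Icc 0 vmax)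
    (hp : ∀ t, 0 ≤ p t) (t : Fin T) :
    overspend vmax ρ v p t ∈ Set.Icc (-(2 * radiusScale T * vmax + vmax)) vmax := by
  have hvmax : 0 ≤ vmax := hρ.le.trans hρv
  have hL := mul_nonneg (radiusScale_nonneg T) hvmax
  have hcost := estCost_mem_Icc hp (Iio t) (hv t)
  rw [overspend, decision_eq]
  split_ifs <;> constructor <;> linarith [hcost.1, hcost.2]

theorem abs_overspend_le (hρ : 0 < ρ) (hρv : ρ ≤ vmax) (hv : ∀ t, v t ∈ Set.Icc 0 vmax)
    (hp : ∀ t, 0 ≤ p t) (t : Fin T) :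
    |overspend vmax ρ v p t| ≤ 2 * vmax * (1 + radiusScale T) := by
  have hL := mul_nonneg (radiusScale_nonneg T) (hρ.le.trans hρv)
  have hover := overspend_mem_Icc hρ hρv hv hp t
  rw [abs_le]
  constructor <;> linarith [hover.1, hover.2]

theorem overspend_nonpos_of_lt_lam (hρ : 0 < ρ) (hv : ∀ t, v t ∈ Set.Icc 0 vmax)
    (hp : ∀ t, 0 ≤ p t) {t : Fin T}
    (hlam : vmax * (1 + radiusScale T) / ρ < (stateAt vmax ρ v p t).lam) :
    overspend vmax ρ v p t ≤ 0 := by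
  rw [overspend, decision_eq]
  split_ifs with hhalted htest
  · exact le_rfl
  · have hrevenue := htest.trans (estRevenue_le hp (Iio t) (hv t))
    rw [div_lt_iff₀ hρ] at hlam
    have hlam_nonneg := lam_stateAt_nonneg (vmax := vmax) (ρ := ρ) (v := v) (p := p) t.isLt.le
    rw [one_mul, sub_nonpos]
    exact (lt_of_mul_lt_mul_left (hrevenue.trans_lt hlam) hlam_nonneg).le
  · linarith

theorem stepSize_mul_le_one (hvmax : 0 < vmax) (t : Fin T) : stepSize vmax t * vmax ≤ 1 := by
  have hsqrt : 1 ≤ √((t : ℝ) + 1) := Real.one_le_sqrt.2 (by simp)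
  rw [stepSize, one_div_mul_eq_div]
  exact div_le_one_of_le₀ (le_mul_of_one_le_right hvmax.le hsqrt) (by positivity)

theorem lam_stateAt_le (hρ : 0 < ρ) (hρv : ρ ≤ vmax) (hv : ∀ t, v t ∈ Set.Icc 0 vmax)
    (hp : ∀ t, 0 ≤ p t) {n : ℕ} (hn : n ≤ T) :
    (stateAt vmax ρ v p n).lam ≤ vmax * (1 + radiusScale T) / ρ + 1 := by
  have hvmax : 0 < vmax := hρ.trans_le hρv
  have hL := radiusScale_nonneg T
  have hbound : 0 ≤ vmax * (1 + radiusScale T) / ρ + 1 := by positivity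
  refine forall_le_of_forall_fin (P := fun n => (stateAt vmax ρ v p n).lam ≤ _) hbound
    (fun t ih => ?_) hn
  rw [lam_stateAt_succ hρ hvmax]
  refine max_le ?_ hbound
  have hη := (stepSize_pos hvmax t).le
  rcases lt_or_ge (vmax * (1 + radiusScale T) / ρ) (stateAt vmax ρ v p t).lam with hlarge | hsmall
  · have hdecrease := mul_nonpos_of_nonneg_of_nonpos hη
      (overspend_nonpos_of_lt_lam hρ hv hp hlarge)
    linarith
  · have hincrease := (mul_le_mul_of_nonneg_left (overspend_mem_Icc hρ hρv hv hp t).2 hη).trans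
      (stepSize_mul_le_one hvmax t)
    linarith

theorem abs_lam_stateAt_sub_le (hρ : 0 < ρ) (hρv : ρ ≤ vmax) (hv : ∀ t, v t ∈ Set.Icc 0 vmax)
    (hp : ∀ t, 0 ≤ p t) {l : ℝ} (hl : l ∈ Set.Icc 0 1) {n : ℕ} (hn : n ≤ T) :
    |(stateAt vmax ρ v p n).lam - l| ≤ (1 + vmax / ρ) * (1 + radiusScale T) := by
  have hvmax : 0 < vmax := hρ.trans_le hρv
  have hL := radiusScale_nonneg T
  have hratio : 0 ≤ vmax * (1 + radiusScale T) / ρ := by positivity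
  have hlam_le := lam_stateAt_le hρ hρv hv hp hn
  have hlam_nonneg := lam_stateAt_nonneg (vmax := vmax) (ρ := ρ) (v := v) (p := p) hn
  rw [add_mul, one_mul, div_mul_eq_mul_div, abs_le]
  constructor <;> linarith [hl.1, hl.2]

theorem sum_overspend_mul_sub_lam_le (hρ : 0 < ρ) (hρv : ρ ≤ vmax)
    (hv : ∀ t, v t ∈ Set.Icc 0 vmax) (hp : ∀ t, 0 ≤ p t) {l : ℝ} (hl : l ∈ Set.Icc 0 1) :
    ∑ t, overspend vmax ρ v p t * (l - (stateAt vmax ρ v p t).lam) ≤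
      vmax * ((1 + vmax / ρ) ^ 2 / 2 + 4) * (1 + radiusScale T) ^ 2 * √T := by
  have hvmax : 0 < vmax := hρ.trans_le hρv
  have hproj : ∀ t : Fin T, ‖(stateAt vmax ρ v p (t + 1)).lam - l‖ ≤
      ‖(stateAt vmax ρ v p t).lam +
        (1 / (vmax * √((t : ℝ) + 1))) • overspend vmax ρ v p t - l‖ := fun t => by
    rw [lam_stateAt_succ hρ hvmax]
    have hmax := abs_max_sub_max_le_abs
      ((stateAt vmax ρ v p t).lam + stepSize vmax t * overspend vmax ρ v p t) l 0
    rwa [max_eq_left hl.1] at hmax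
  have hregret := sum_inner_sub_le_of_gradient_steps (x := fun n => (stateAt vmax ρ v p n).lam)
    hvmax (fun n => abs_lam_stateAt_sub_le hρ hρv hv hp hl) (abs_overspend_le hρ hρv hv hp) hproj
  calc ∑ t, overspend vmax ρ v p t * (l - (stateAt vmax ρ v p t).lam)
    _ = ∑ t, inner ℝ (overspend vmax ρ v p t) (l - (stateAt vmax ρ v p t).lam) := by
        simp [mul_comm]
    _ ≤ _ := hregret
    _ = vmax * ((1 + vmax / ρ) ^ 2 / 2 + 4) * (1 + radiusScale T) ^ 2 * √T := by
        field_simp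
        ring

theorem mul_add_mul_le_of_test {q lam c r b : ℝ} (hq : q ∈ Set.Icc 0 1) (hlam : 0 ≤ lam)
    (hc : c ≤ b) :
    q * r + lam * ((if lam * c ≤ r then 1 else 0) * c - q * b) ≤
      (if lam * c ≤ r then 1 else 0) * r := by
  have hcb : lam * c ≤ lam * b := by gcongr
  split_ifs with htest
  · nlinarith [mul_le_mul_of_nonneg_left hcb hq.1,
      mul_le_mul_of_nonneg_left htest (sub_nonneg.2 hq.2)]
  · nlinarith [mul_le_mul_of_nonneg_left ((not_le.1 htest).le.trans hcb) hq.1]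

theorem mul_add_overspend_mul_le_decision_mul (hρ : 0 < ρ) (hρv : ρ ≤ vmax)
    (hv : ∀ t, v t ∈ Set.Icc 0 vmax) (hp : ∀ t, 0 ≤ p t) {l : ℝ} (hl : l ∈ Set.Icc 0 1) {t : Fin T}
    (hhalt : (stateAt vmax ρ v p t).halted → l = 1) {r c : ℝ} (hr : r ≤ vmax) :
    ρ / vmax * r + overspend vmax ρ v p t * ((stateAt vmax ρ v p t).lam - l) +
        l * (decision vmax ρ v p t * c - ρ) ≤
      decision vmax ρ v p t * r + |(𝔼 τ ∈ Iio t, revenue (v t) (p τ)) - r| +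
        |(𝔼 τ ∈ Iio t, cost (v t) (p τ)) - c| + 3 * vmax * radius (Iio t) := by
  have hvmax : 0 < vmax := hρ.trans_le hρv
  have hq : ρ / vmax ∈ Set.Icc 0 1 := ⟨by positivity, div_le_one_of_le₀ hρv hvmax.le⟩
  have hqb : ρ / vmax * vmax = ρ := div_mul_cancel₀ _ hvmax.ne'
  have hradius : 0 ≤ radius (Iio t) := radius_nonneg _
  by_cases hhalted : (stateAt vmax ρ v p t).halted
  · rw [overspend, if_pos hhalted, decision_eq_zero_of_halted hhalted, hhalt hhalted]
    have hqr : ρ / vmax * r ≤ ρ / vmax * vmax := mul_le_mul_of_nonneg_left hr hq.1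
    have hnonneg : 0 ≤ 3 * vmax * radius (Iio t) := by positivity
    linarith [abs_nonneg ((𝔼 τ ∈ Iio t, revenue (v t) (p τ)) - r),
      abs_nonneg ((𝔼 τ ∈ Iio t, cost (v t) (p τ)) - c)]
  have hx := decision_mem_Icc (vmax := vmax) (ρ := ρ) (v := v) (p := p) t
  have htest : ρ / vmax * estRevenue p (Iio t) (v t) + (stateAt vmax ρ v p t).lam *
      (decision vmax ρ v p t * estCost p (Iio t) (v t) - ρ) ≤
        decision vmax ρ v p t * estRevenue p (Iio t) (v t) := by
    rw [decision_eq, if_neg hhalted]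
    simpa only [hqb] using mul_add_mul_le_of_test hq (lam_stateAt_nonneg t.isLt.le)
      (estCost_mem_Icc hp (Iio t) (hv t)).2
  have hrevenue : (ρ / vmax - decision vmax ρ v p t) * (r - estRevenue p (Iio t) (v t)) ≤
      |(𝔼 τ ∈ Iio t, revenue (v t) (p τ)) - r| + vmax * radius (Iio t) :=
    (mul_le_abs_of_abs_le_one (abs_sub_le_one_of_mem_Icc hq hx)).trans
      (abs_sub_estRevenue_le (hv t))
  have hcost : l * decision vmax ρ v p t * (c - estCost p (Iio t) (v t)) ≤
      |(𝔼 τ ∈ Iio t, cost (v t) (p τ)) - c| + 2 * vmax * radius (Iio t) :=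
    (mul_le_abs_of_abs_le_one (abs_le.2 ⟨by linarith [mul_nonneg hl.1 hx.1],
      mul_le_one₀ hl.2 hx.1 hx.2⟩)).trans (abs_sub_estCost_le (hv t))
  rw [overspend, if_neg hhalted]
  linarith

theorem sum_mul_revenue_le {x : Fin T → ℝ} (hx : ∀ t, x t = 0 ∨ x t = 1) :
    ∑ t, x t * revenue (v t) (p t) ≤ ∑ t, revenue (v t) (p t) :=
  sum_le_sum fun t _ => mul_le_of_le_one_left (revenue_nonneg _ _)
    (by rcases hx t with h | h <;> simp [h])

theorem hindsight_mem_Icc : hindsight ρ v p ∈ Set.Icc 0 (∑ t, revenue (v t) (p t)) := by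
  refine ⟨Real.sSup_nonneg ?_, Real.sSup_le ?_ (sum_nonneg fun t _ => revenue_nonneg _ _)⟩
  · rintro _ ⟨x, hx, -, rfl⟩
    exact sum_nonneg fun t _ => mul_nonneg (by rcases hx t with h | h <;> simp [h])
      (revenue_nonneg _ _)
  · rintro _ ⟨x, hx, -, rfl⟩
    exact sum_mul_revenue_le hx

theorem mul_hindsight_le {q : ℝ} (hq : q ∈ Set.Icc 0 1) (r : Fin T → ℝ) :
    q * hindsight ρ v p ≤ q * ∑ t, r t + |∑ t, (revenue (v t) (p t) - r t)| := by
  have hq_abs : |q| ≤ 1 := (abs_of_nonneg hq.1).trans_le hq.2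
  calc q * hindsight ρ v p
    _ ≤ q * ∑ t, revenue (v t) (p t) := mul_le_mul_of_nonneg_left hindsight_mem_Icc.2 hq.1
    _ = q * ∑ t, r t + q * ∑ t, (revenue (v t) (p t) - r t) := by rw [sum_sub_distrib]; ring
    _ ≤ q * ∑ t, r t + |∑ t, (revenue (v t) (p t) - r t)| := by
        gcongr; exact mul_le_abs_of_abs_le_one hq_abs

/-- The total error made along a run by replacing the revenue and the cost of round `t`, and their
empirical means over the past bids, by `r t` and `c t`. -/
noncomputable def samplingError (vmax ρ : ℝ) {T : ℕ} (v p r c : Fin T → ℝ) : ℝ :=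
  |∑ t, (revenue (v t) (p t) - r t)| + |∑ t, decision vmax ρ v p t * (revenue (v t) (p t) - r t)| +
    |∑ t, decision vmax ρ v p t * (cost (v t) (p t) - c t)| +
    ∑ t, |(𝔼 τ ∈ Iio t, revenue (v t) (p τ)) - r t| + ∑ t, |(𝔼 τ ∈ Iio t, cost (v t) (p τ)) - c t|

-- By complementary slackness the comparator for the pricing variable is `1` if the budget ran out
-- and `0` otherwise.
theorem exists_comparator (hvmax : 0 ≤ vmax) :
    ∃ l ∈ Set.Icc (0 : ℝ) 1, (∀ t : Fin T, (stateAt vmax ρ v p t).halted → l = 1) ∧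
      l * (ρ * T - ∑ t, decision vmax ρ v p t * cost (v t) (p t)) ≤ vmax := by
  rw [← budget_stateAt_last]
  by_cases hhalted : (stateAt vmax ρ v p T).halted
  · refine ⟨1, ⟨zero_le_one, le_rfl⟩, fun _ _ => rfl, ?_⟩
    rw [one_mul]
    exact (budget_stateAt_lt_of_halted le_rfl hhalted).le
  · refine ⟨0, ⟨le_rfl, zero_le_one⟩, fun t ht => ?_, by rwa [zero_mul]⟩
    exact absurd (monotone_halted_stateAt t.isLt.le ht) hhalted

theorem mul_sum_add_budget_mul_le_sum_decision_mul (hρ : 0 < ρ) (hρv : ρ ≤ vmax)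
    (hv : ∀ t, v t ∈ Set.Icc 0 vmax) (hp : ∀ t, 0 ≤ p t) {l : ℝ} (hl : l ∈ Set.Icc 0 1)
    (hhalt : ∀ t : Fin T, (stateAt vmax ρ v p t).halted → l = 1) {r c : Fin T → ℝ}
    (hr : ∀ t, r t ≤ vmax) :
    ρ / vmax * ∑ t, r t + l * (∑ t, decision vmax ρ v p t * c t - ρ * T) ≤
      ∑ t, decision vmax ρ v p t * r t +
        ∑ t, |(𝔼 τ ∈ Iio t, revenue (v t) (p τ)) - r t| +
        ∑ t, |(𝔼 τ ∈ Iio t, cost (v t) (p τ)) - c t| +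
        vmax * ((1 + vmax / ρ) ^ 2 / 2 + 4) * (1 + radiusScale T) ^ 2 * √T +
        12 * vmax * radiusScale T * √T := by
  have hround := sum_le_sum fun t (_ : t ∈ univ) =>
    mul_add_overspend_mul_le_decision_mul hρ hρv hv hp hl (hhalt t) (c := c t) (hr t)
  have hregret := sum_overspend_mul_sub_lam_le hρ hρv hv hp hl
  have hradius := mul_le_mul_of_nonneg_left (sum_radius_Iio_le T)
    (mul_nonneg zero_le_three (hρ.le.trans hρv))
  simp only [sum_add_distrib, mul_sub, sum_sub_distrib, ← mul_sum, sum_const, card_univ,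
    Fintype.card_fin, nsmul_eq_mul] at hround hregret ⊢
  linarith

theorem mul_hindsight_sub_ogdcbRevenue_le (hρ : 0 < ρ) (hρv : ρ ≤ vmax)
    (hv : ∀ t, v t ∈ Set.Icc 0 vmax) (hp : ∀ t, 0 ≤ p t) (hT : 0 < T) {r c : Fin T → ℝ}
    (hr : ∀ t, r t ≤ vmax) :
    ρ / vmax * hindsight ρ v p - ogdcbRevenue vmax ρ v p ≤ samplingError vmax ρ v p r c +
      vmax * ((1 + vmax / ρ) ^ 2 / 2 + 10) * (1 + radiusScale T) ^ 2 * √T := by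
  have hvmax : 0 < vmax := hρ.trans_le hρv
  obtain ⟨l, hl, hhalt, hslack⟩ := exists_comparator (ρ := ρ) (v := v) (p := p) hvmax.le
  have hround := mul_sum_add_budget_mul_le_sum_decision_mul hρ hρv hv hp hl hhalt (c := c) hr
  have hhindsight := mul_hindsight_le (ρ := ρ) (v := v) (p := p) ⟨by positivity,
    div_le_one_of_le₀ hρv hvmax.le⟩ r
  have hrevenue : ∑ t, decision vmax ρ v p t * r t - ogdcbRevenue vmax ρ v p ≤
      |∑ t, decision vmax ρ v p t * (revenue (v t) (p t) - r t)| := by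
    refine le_trans ?_ (neg_le_abs _)
    simp only [ogdcbRevenue_eq_sum_decision, mul_sub, sum_sub_distrib, neg_sub, le_refl]
  have hcost : l * (∑ t, decision vmax ρ v p t * cost (v t) (p t) -
      ∑ t, decision vmax ρ v p t * c t) ≤
        |∑ t, decision vmax ρ v p t * (cost (v t) (p t) - c t)| := by
    simpa only [mul_sub, sum_sub_distrib] using mul_le_abs_of_abs_le_one (abs_le.2
      ⟨by linarith [hl.1], hl.2⟩) (x := ∑ t, decision vmax ρ v p t * (cost (v t) (p t) - c t))
  have hconst : vmax + 12 * vmax * radiusScale T * √T ≤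
      6 * vmax * (1 + radiusScale T) ^ 2 * √T := by
    have hsqrt : 1 ≤ √(T : ℝ) := Real.one_le_sqrt.2 (by exact_mod_cast hT)
    nlinarith [mul_le_mul_of_nonneg_left hsqrt hvmax.le,
      mul_nonneg hvmax.le (mul_nonneg (sq_nonneg (radiusScale T)) (Real.sqrt_nonneg T))]
  rw [samplingError]
  linarith

end Run

section Predictability

variable {vmax ρ : ℝ} {T : ℕ} {v p q : Fin T → ℝ}

theorem estRevenue_congr {I : Finset (Fin T)} (h : ∀ τ ∈ I, p τ = q τ) (w : ℝ) :
    estRevenue p I w = estRevenue q I w := by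
  rw [estRevenue, estRevenue, sum_congr rfl fun τ hτ => by rw [h τ hτ]]

theorem estCost_congr {I : Finset (Fin T)} (h : ∀ τ ∈ I, p τ = q τ) (w : ℝ) :
    estCost p I w = estCost q I w := by
  rw [estCost, estCost, sum_congr rfl fun τ hτ => by rw [h τ hτ]]

theorem action_congr {s : State T} (h : ∀ τ ∈ s.sampled, p τ = q τ) (t : Fin T) (w : ℝ) :
    action p s t w = action q s t w := by
  rw [action, action, estRevenue_congr h, estCost_congr h]

theorem step_congr {s : State T} {t : Fin T} (h : ∀ τ ∈ s.sampled, p τ = q τ) (ht : p t = q t) :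
    step vmax ρ v p s t = step vmax ρ v q s t := by
  rw [step, step, action_congr h, estCost_congr h, ht]

theorem val_lt_of_mem_sampled_stateAt {n : ℕ} {τ : Fin T}
    (hτ : τ ∈ (stateAt vmax ρ v p n).sampled) : τ.val < n := by
  induction n with
  | zero => exact absurd hτ (notMem_empty τ)
  | succ n ih =>
    rw [stateAt] at hτ
    split_ifs at hτ with hn
    · rw [step] at hτ
      by_cases hhalted : (stateAt vmax ρ v p n).halted
      · rw [if_pos hhalted] at hτ
        exact (ih hτ).trans n.lt_succ_self
      · rw [if_neg hhalted] at hτ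
        rcases mem_insert.1 hτ with rfl | hτ
        · exact n.lt_succ_self
        · exact (ih hτ).trans n.lt_succ_self
    · exact (ih hτ).trans n.lt_succ_self

theorem stateAt_congr {n : ℕ} (h : ∀ τ : Fin T, τ.val < n → p τ = q τ) :
    stateAt vmax ρ v p n = stateAt vmax ρ v q n := by
  induction n with
  | zero => rfl
  | succ n ih =>
    have ih := ih fun τ hτ => h τ (hτ.trans n.lt_succ_self)
    rw [stateAt, stateAt, ih]
    split_ifs with hn
    · exact step_congr
        (fun τ hτ => h τ ((val_lt_of_mem_sampled_stateAt hτ).trans n.lt_succ_self))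
        (h ⟨n, hn⟩ n.lt_succ_self)
    · rfl

theorem dependsOn_decision (t : Fin T) :
    DependsOn (fun p => decision vmax ρ v p t) (Set.Iio t) := by
  intro p q h
  have hstate : stateAt vmax ρ v p t = stateAt vmax ρ v q t := stateAt_congr h
  simp only [decision, hstate]
  exact action_congr (fun τ hτ => h τ (val_lt_of_mem_sampled_stateAt hτ)) t _

theorem measurable_revenue (w : ℝ) : Measurable (revenue w) :=
  (measurable_const.sub measurable_id).max measurable_const

theorem measurable_cost (w : ℝ) : Measurable (cost w) :=
  Measurable.ite measurableSet_Iic measurable_id measurable_const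

theorem measurable_estRevenue (I : Finset (Fin T)) (w : ℝ) :
    Measurable fun p : Fin T → ℝ => estRevenue p I w :=
  ((Finset.measurable_fun_sum _ fun τ _ =>
    (measurable_revenue w).comp (measurable_pi_apply τ)).div_const _).add_const _

theorem measurable_estCost (I : Finset (Fin T)) (w : ℝ) :
    Measurable fun p : Fin T → ℝ => estCost p I w :=
  ((Finset.measurable_fun_sum _ fun τ _ =>
    (measurable_cost w).comp (measurable_pi_apply τ)).div_const _).sub_const _

theorem measurable_decision_of_measurable_stateAt {t : Fin T}
    (hlam : Measurable fun p => (stateAt vmax ρ v p t).lam)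
    (hhalted : MeasurableSet {p | (stateAt vmax ρ v p t).halted}) :
    Measurable fun p => decision vmax ρ v p t := by
  simp only [decision_eq]
  exact Measurable.ite hhalted measurable_const (Measurable.ite (measurableSet_le
    (hlam.mul (measurable_estCost _ _)) (measurable_estRevenue _ _)) measurable_const
    measurable_const)

theorem measurable_stateAt (hρ : 0 < ρ) (hvmax : 0 < vmax) {n : ℕ} (hn : n ≤ T) :
    (Measurable fun p => (stateAt vmax ρ v p n).lam) ∧
      (Measurable fun p => (stateAt vmax ρ v p n).budget) ∧
      MeasurableSet {p | (stateAt vmax ρ v p n).halted} := by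
  refine forall_le_of_forall_fin (P := fun n => (Measurable fun p => (stateAt vmax ρ v p n).lam) ∧
      (Measurable fun p => (stateAt vmax ρ v p n).budget) ∧
      MeasurableSet {p | (stateAt vmax ρ v p n).halted})
    ⟨measurable_const, measurable_const, MeasurableSet.const (false = true)⟩ (fun t ih => ?_) hn
  obtain ⟨hlam, hbudget, hhalted⟩ := ih
  have hdecision := measurable_decision_of_measurable_stateAt hlam hhalted
  have hoverspend : Measurable fun p => overspend vmax ρ v p t :=
    Measurable.ite hhalted measurable_const
      ((hdecision.mul (measurable_estCost _ _)).sub_const ρ)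
  have hbudget_succ : Measurable fun p => (stateAt vmax ρ v p (t + 1)).budget := by
    simp only [budget_stateAt_succ]
    exact hbudget.sub (hdecision.mul ((measurable_cost _).comp (measurable_pi_apply t)))
  refine ⟨?_, hbudget_succ, ?_⟩
  · simp only [lam_stateAt_succ hρ hvmax]
    exact (hlam.add (hoverspend.const_mul _)).max measurable_const
  · simp only [halted_stateAt_succ, Set.ofPred_or]
    exact hhalted.union (measurableSet_lt hbudget_succ measurable_const)

theorem measurable_decision (hρ : 0 < ρ) (hvmax : 0 < vmax) (t : Fin T) :
    Measurable fun p => decision vmax ρ v p t :=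
  have hstate := measurable_stateAt hρ hvmax t.isLt.le
  measurable_decision_of_measurable_stateAt hstate.1 hstate.2.2

theorem measurable_ogdcbRevenue (hρ : 0 < ρ) (hvmax : 0 < vmax) :
    Measurable fun p => ogdcbRevenue vmax ρ v p := by
  simp only [ogdcbRevenue_eq_sum_decision]
  exact Finset.measurable_fun_sum _ fun t _ => (measurable_decision hρ hvmax t).mul
    ((measurable_revenue _).comp (measurable_pi_apply t))

theorem hindsight_eq_iSup :
    hindsight ρ v p = ⨆ S : Finset (Fin T),
      if ∑ t ∈ S, cost (v t) (p t) ≤ T * ρ then ∑ t ∈ S, revenue (v t) (p t) else 0 := by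
  have hbdd : BddAbove {R : ℝ | ∃ x : Fin T → ℝ, (∀ t, x t = 0 ∨ x t = 1) ∧
      ∑ t, x t * cost (v t) (p t) ≤ T * ρ ∧ R = ∑ t, x t * revenue (v t) (p t)} := by
    refine ⟨∑ t, revenue (v t) (p t), ?_⟩
    rintro _ ⟨x, hx, -, rfl⟩
    exact sum_mul_revenue_le hx
  refine le_antisymm (Real.sSup_le ?_ (Real.iSup_nonneg fun S => ?_)) (ciSup_le fun S => ?_)
  · rintro _ ⟨x, hx, hcost, rfl⟩
    refine le_ciSup_of_le (Set.finite_range _).bddAbove (univ.filter fun t => x t = 1) ?_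
    have hsum (f : Fin T → ℝ) : ∑ t with x t = 1, f t = ∑ t, x t * f t := by
      rw [sum_filter]
      refine sum_congr rfl fun t _ => ?_
      rcases hx t with h | h <;> simp [h]
    rw [hsum, hsum, if_pos hcost]
  · split_ifs
    · exact sum_nonneg fun t _ => revenue_nonneg _ _
    · exact le_rfl
  · have hsum (f : Fin T → ℝ) : ∑ t ∈ S, f t = ∑ t, (if t ∈ S then 1 else 0) * f t := by simp
    split_ifs with hcost
    · exact le_csSup hbdd ⟨fun t => if t ∈ S then 1 else 0, fun t => (ite_eq_or_eq _ _ _).symm,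
        by rwa [← hsum], hsum _⟩
    · exact hindsight_mem_Icc.1

theorem measurable_hindsight : Measurable fun p => hindsight ρ v p := by
  have hsum (S : Finset (Fin T)) {f : ℝ → ℝ → ℝ} (hf : ∀ w, Measurable (f w)) :
      Measurable fun p : Fin T → ℝ => ∑ t ∈ S, f (v t) (p t) :=
    Finset.measurable_fun_sum _ fun t _ => (hf (v t)).comp (measurable_pi_apply t)
  simp only [hindsight_eq_iSup]
  exact .iSup fun S => .ite (measurableSet_le (hsum S measurable_cost) measurable_const)
    (hsum S measurable_revenue) measurable_const

end Predictability

section Expectation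

variable {vmax ρ : ℝ} {T : ℕ}

theorem revenue_coe_mem_Icc (w x : Set.Icc (0 : ℝ) vmax) : revenue w x ∈ Set.Icc 0 vmax :=
  Set.Icc_subset_Icc_right w.2.2 (revenue_mem_Icc w.2.1 x.2.1)

theorem cost_coe_mem_Icc (w x : Set.Icc (0 : ℝ) vmax) : cost w x ∈ Set.Icc 0 vmax :=
  Set.Icc_subset_Icc_right w.2.2 (cost_mem_Icc w.2.1 x.2.1)

theorem measurable_revenue_coe (w : ℝ) : Measurable fun x : Set.Icc (0 : ℝ) vmax => revenue w x :=
  (measurable_revenue w).comp measurable_subtype_coe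

theorem measurable_cost_coe (w : ℝ) : Measurable fun x : Set.Icc (0 : ℝ) vmax => cost w x :=
  (measurable_cost w).comp measurable_subtype_coe

theorem measurable_decision_coe (hρ : 0 < ρ) (hvmax : 0 < vmax) (v : Fin T → ℝ) (t : Fin T) :
    Measurable fun p : Fin T → Set.Icc (0 : ℝ) vmax => decision vmax ρ v (fun t => p t) t :=
  (measurable_decision hρ hvmax t).comp (by fun_prop)

theorem dependsOn_decision_coe (v : Fin T → ℝ) (t : Fin T) :
    DependsOn (fun p : Fin T → Set.Icc (0 : ℝ) vmax => decision vmax ρ v (fun t => p t) t)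
      (Set.Iio t) :=
  fun _ _ h => dependsOn_decision t fun τ hτ => congrArg Subtype.val (h τ hτ)

theorem abs_decision_le_one (v p : Fin T → ℝ) (t : Fin T) : |decision vmax ρ v p t| ≤ 1 :=
  abs_le.2 ⟨by linarith [(decision_mem_Icc (vmax := vmax) (ρ := ρ) (v := v) (p := p) t).1],
    (decision_mem_Icc t).2⟩

variable (v : Fin T → Set.Icc (0 : ℝ) vmax)

theorem sum_revenue_le (p : Fin T → Set.Icc (0 : ℝ) vmax) :
    ∑ t, revenue (v t) (p t) ≤ T * vmax := by
  refine (sum_le_card_nsmul _ _ vmax fun t _ =>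
    (revenue_coe_mem_Icc (v t) (p t)).2).trans_eq ?_
  rw [card_univ, Fintype.card_fin, nsmul_eq_mul]

section

variable (μ : Measure (Fin T → Set.Icc (0 : ℝ) vmax)) [IsFiniteMeasure μ]

theorem integrable_hindsight :
    Integrable (fun p : Fin T → Set.Icc (0 : ℝ) vmax =>
      hindsight ρ (fun t => v t) fun t => p t) μ :=
  .of_mem_Icc 0 (T * vmax) (measurable_hindsight.comp (by fun_prop)).aemeasurable
    (.of_forall fun p => ⟨hindsight_mem_Icc.1, hindsight_mem_Icc.2.trans (sum_revenue_le v p)⟩)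

theorem integrable_ogdcbRevenue (hρ : 0 < ρ) (hvmax : 0 < vmax) :
    Integrable (fun p : Fin T → Set.Icc (0 : ℝ) vmax =>
      ogdcbRevenue vmax ρ (fun t => v t) fun t => p t) μ := by
  refine .of_mem_Icc 0 (T * vmax)
    ((measurable_ogdcbRevenue hρ hvmax).comp (by fun_prop)).aemeasurable (.of_forall fun p => ?_)
  rw [ogdcbRevenue_eq_sum_decision]
  exact ⟨sum_nonneg fun t _ => mul_nonneg (decision_mem_Icc t).1 (revenue_nonneg _ _),
    (sum_le_sum fun t _ => mul_le_of_le_one_left (revenue_nonneg _ _)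
      (decision_mem_Icc t).2).trans (sum_revenue_le v p)⟩

theorem integrable_gap (hρ : 0 < ρ) (hvmax : 0 < vmax) (κ : ℝ) :
    Integrable (fun p => gap vmax ρ κ v p) μ :=
  (integrable_ogdcbRevenue v μ hρ hvmax).sub ((integrable_hindsight v μ).const_mul κ)

end

variable (G : Measure (Set.Icc (0 : ℝ) vmax)) [IsProbabilityMeasure G]

theorem hasIntegralLE_samplingError (hρ : 0 < ρ) (hvmax : 0 < vmax) :
    HasIntegralLE (Measure.pi fun _ => G)
      (fun p : Fin T → Set.Icc (0 : ℝ) vmax => samplingError vmax ρ (fun t => v t) (fun t => p t)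
        (fun t => ∫ x, revenue (v t) x ∂G) (fun t => ∫ x, cost (v t) x ∂G))
      (11 * vmax * √T) := by
  have hrevenue := fun t => measurable_revenue_coe (vmax := vmax) (v t)
  have hcost := fun t => measurable_cost_coe (vmax := vmax) (v t)
  have hrevenue_mem := fun t => revenue_coe_mem_Icc (v t)
  have hcost_mem := fun t => cost_coe_mem_Icc (v t)
  have hdecision := measurable_decision_coe (T := T) hρ hvmax fun t => v t
  have hdecision_le (t : Fin T) (p : Fin T → Set.Icc (0 : ℝ) vmax) :=
    abs_decision_le_one (vmax := vmax) (ρ := ρ) (fun t => v t) (fun t => p t) t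
  have hdep := dependsOn_decision_coe (vmax := vmax) (ρ := ρ) fun t => v t
  have hbenchmark := hasIntegralLE_abs_sum_mul_sub_integral (G := G) univ (X := fun _ _ => 1)
    (fun _ => measurable_const) (fun _ _ => abs_one.le) (fun _ _ _ _ => rfl) hrevenue hrevenue_mem
  have hearned := hasIntegralLE_abs_sum_mul_sub_integral (G := G) univ hdecision hdecision_le hdep
    hrevenue hrevenue_mem
  have hspent := hasIntegralLE_abs_sum_mul_sub_integral (G := G) univ hdecision hdecision_le hdep
    hcost hcost_mem
  simp only [one_mul, card_univ, Fintype.card_fin, sub_zero] at hbenchmark hearned hspent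
  have htotal := (((hbenchmark.add hearned).add hspent).add
    (hasIntegralLE_sum_abs_expect_Iio_sub_integral hrevenue hvmax.le hrevenue_mem)).add
    (hasIntegralLE_sum_abs_expect_Iio_sub_integral hcost hvmax.le hcost_mem)
  exact ⟨htotal.1, htotal.2.trans_eq (by ring)⟩

/-- The bound on the expected shortfall of OGD-CB against `ρ / v_max` times the benchmark. -/
noncomputable def lossBound (vmax ρ : ℝ) (T : ℕ) : ℝ :=
  vmax * ((1 + vmax / ρ) ^ 2 / 2 + 21) * (1 + radiusScale T) ^ 2 * √T

theorem neg_lossBound_le_integral_gap (hρ : 0 < ρ) (hρv : ρ ≤ vmax) (hT : 0 < T) :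
    -lossBound vmax ρ T ≤ ∫ p, gap vmax ρ (ρ / vmax) v p ∂(Measure.pi fun _ => G) := by
  have hvmax : 0 < vmax := hρ.trans_le hρv
  have hsampling := hasIntegralLE_samplingError v G hρ hvmax
  set K := vmax * ((1 + vmax / ρ) ^ 2 / 2 + 10) * (1 + radiusScale T) ^ 2 * √T with hK
  have hmean (t : Fin T) : ∫ x, revenue (v t) x ∂G ≤ vmax :=
    ((convex_Icc 0 vmax).integral_mem isClosed_Icc (.of_forall (revenue_coe_mem_Icc (v t)))
      (.of_mem_Icc 0 vmax (measurable_revenue_coe _).aemeasurable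
        (.of_forall (revenue_coe_mem_Icc (v t))))).2
  have hloss := integral_mono (integrable_gap v (Measure.pi fun _ => G) hρ hvmax (ρ / vmax)).neg
    (hsampling.1.add (integrable_const K)) fun p => (neg_sub _ _).trans_le
      (mul_hindsight_sub_ogdcbRevenue_le hρ hρv (fun t => (v t).2) (fun t => (p t).2.1) hT hmean)
  have hscale : 11 * vmax * √T ≤ 11 * vmax * (1 + radiusScale T) ^ 2 * √T := by
    have hone : 1 ≤ (1 + radiusScale T) ^ 2 :=
      one_le_pow₀ (le_add_of_nonneg_right (radiusScale_nonneg T))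
    exact mul_le_mul_of_nonneg_right (le_mul_of_one_le_right (by positivity) hone)
      (Real.sqrt_nonneg _)
  simp only [Pi.neg_apply, Pi.add_apply, integral_neg,
    integral_add hsampling.1 (integrable_const K),
    integral_const, probReal_univ, one_smul] at hloss
  rw [lossBound]
  linarith [hsampling.2]

end Expectation

theorem tendsto_sqrt_div_atTop : Tendsto (fun T : ℕ => √(T : ℝ) / T) atTop (𝓝 0) := by
  simp only [Real.sqrt_div_self', one_div]
  exact (Real.tendsto_sqrt_atTop.comp tendsto_natCast_atTop_atTop).inv_tendsto_atTop

theorem tendsto_log_mul_sqrt_div_atTop :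
    Tendsto (fun T : ℕ => Real.log T * (√(T : ℝ) / T)) atTop (𝓝 0) := by
  simp only [Real.sqrt_div_self', mul_one_div]
  simp only [Real.sqrt_eq_rpow]
  exact (isLittleO_log_rpow_atTop one_half_pos).tendsto_div_nhds_zero.comp
    tendsto_natCast_atTop_atTop

theorem one_add_radiusScale_sq_le (T : ℕ) :
    (1 + radiusScale T) ^ 2 ≤ 2 + Real.log 2 + 2 * Real.log T := by
  have hsq : radiusScale T ^ 2 = (Real.log 2 + 2 * Real.log T) / 2 :=
    Real.sq_sqrt (by positivity)
  linarith [add_sq_le (a := 1) (b := radiusScale T)]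

theorem tendsto_one_add_radiusScale_sq_mul_sqrt_div :
    Tendsto (fun T : ℕ => (1 + radiusScale T) ^ 2 * (√(T : ℝ) / T)) atTop (𝓝 0) := by
  have hbound := (tendsto_sqrt_div_atTop.const_mul (2 + Real.log 2)).add
    (tendsto_log_mul_sqrt_div_atTop.const_mul 2)
  simp only [mul_zero, add_zero, ← mul_assoc, ← add_mul] at hbound
  exact squeeze_zero (fun T => by positivity)
    (fun T => mul_le_mul_of_nonneg_right (one_add_radiusScale_sq_le T) (by positivity)) hbound

theorem tendsto_lossBound_div (vmax ρ : ℝ) :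
    Tendsto (fun T : ℕ => 1 / (T : ℝ) * lossBound vmax ρ T) atTop (𝓝 0) := by
  have h := tendsto_one_add_radiusScale_sq_mul_sqrt_div.const_mul
    (vmax * ((1 + vmax / ρ) ^ 2 / 2 + 21))
  rw [mul_zero] at h
  refine h.congr fun T => ?_
  rw [lossBound]
  ring

end Throttling

theorem mainTheorem5 (vmax ρ : ℝ) (hρ : 0 < ρ) (hρv : ρ ≤ vmax) :
    (∀ (T : ℕ) (v : Fin T → Set.Icc (0 : ℝ) vmax)
        (G : MeasureTheory.ProbabilityMeasure (Set.Icc (0 : ℝ) vmax)),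
      MeasureTheory.Integrable
        (fun p : Fin T → Set.Icc (0 : ℝ) vmax => Throttling.gap vmax ρ (ρ / vmax) v p)
        (MeasureTheory.Measure.pi
          (fun _ : Fin T => (G : MeasureTheory.Measure (Set.Icc (0 : ℝ) vmax))))) ∧
    (0 : EReal) ≤ Filter.liminf
      (fun T : ℕ =>
        ⨅ (v : Fin T → Set.Icc (0 : ℝ) vmax)
          (G : MeasureTheory.ProbabilityMeasure (Set.Icc (0 : ℝ) vmax)),
          (((1 / (T : ℝ)) *
            ∫ p : Fin T → Set.Icc (0 : ℝ) vmax, Throttling.gap vmax ρ (ρ / vmax) v p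
              ∂(MeasureTheory.Measure.pi
                (fun _ : Fin T => (G : MeasureTheory.Measure (Set.Icc (0 : ℝ) vmax)))) : ℝ) :
            EReal))
      Filter.atTop := by
  have hvmax : 0 < vmax := hρ.trans_le hρv
  refine ⟨fun T v G => Throttling.integrable_gap v _ hρ hvmax _, ?_⟩
  have hlim : Filter.Tendsto
      (fun T : ℕ => ((-(1 / (T : ℝ) * Throttling.lossBound vmax ρ T) : ℝ) : EReal))
      Filter.atTop (nhds 0) := by
    have h := (Throttling.tendsto_lossBound_div vmax ρ).neg
    rw [neg_zero] at h
    exact (continuous_coe_real_ereal.tendsto (0 : ℝ)).comp h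
  rw [← hlim.liminf_eq]
  refine Filter.liminf_le_liminf ?_
  filter_upwards [Filter.eventually_gt_atTop 0] with T hT
  refine le_iInf fun v => le_iInf fun G => EReal.coe_le_coe_iff.2 ?_
  rw [← mul_neg]
  exact mul_le_mul_of_nonneg_left
    (Throttling.neg_lossBound_le_integral_gap v (G : MeasureTheory.Measure _) hρ hρv hT)
    (by positivity)
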